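/- Let $\mathbb{CP}(1) = \mathbb{C}\cup\{\infty\}$ be the Riemann sphere. By an open disc in $\mathbb{CP}(1)$ we mean the image of the open unit disc $\{z\in\mathbb{C} : |z|<1\}$ under a Möbius transformation $z\mapsto \frac{az+b}{cz+d}$ with $a,b,c,d\in\mathbb{C}$, $ad-bc\neq 0$. Let $A\subset\mathbb{CP}(1)$ be any six-element set. Then there exist three pairwise disjoint open discs $D_1,D_2,D_3\subset\mathbb{CP}(1)$ such that $D_j\cap A$ consists of exactly two points for every $j\in\{1,2,3\}$. -/

import Mathlib

/-- An open disc in the Riemann sphere `ℂ ∪ {∞}`: the image of the open unit disc under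
a Möbius transformation `z ↦ (a z + b) / (c z + d)`, `a d - b c ≠ 0`, that is, under the
action of an element of `GL(2, ℂ)` on `OnePoint ℂ`. -/
def IsOpenDisc (D : Set (OnePoint ℂ)) : Prop :=
  ∃ g : Matrix.GeneralLinearGroup (Fin 2) ℂ,
    D = (fun z : OnePoint ℂ => g • z) '' ((fun w : ℂ => (w : OnePoint ℂ)) '' Metric.ball (0 : ℂ) 1)

open Filter Topology

/-! Put the points on the unit sphere by stereographic projection. A Möbius map makes their centroid
zero (`exists_smul_sum_toSphere_eq_zero`): it comes from a minimum over upper half-space of a sum of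
Busemann functions, the logarithm of `distProd`. Now choose the perfect matching that maximizes the
sum of inner products within pairs. Over each pair take the cap cut off by the plane through the
chord's midpoint `m` normal to `m`, slightly enlarged so that the open cap contains both points. For
two midpoints, maximality gives `⟪m, n⟫ ≤ ‖m‖² + ‖n‖² - 1`, and zero centroid gives `‖m + n‖ < 1`,
since `-(m + n)` is the third midpoint. These two inequalities force the caps apart
(`inner_midpoint_lt`, `caps_separate`). Finally pull the caps back by the inverse Möbius map. -/

/-! ### Separation of spherical caps -/

/-- Cauchy–Schwarz for the components of `m` and `n` orthogonal to a common point `x` of the two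
caps. Used contrapositively, as a disjointness test. -/
theorem caps_separate {E : Type*} [NormedAddCommGroup E] [InnerProductSpace ℝ E] {x m n : E}
    {p q : ℝ} (hx : ‖x‖ = 1) (hp : 0 ≤ p) (hq : 0 ≤ q)
    (hm : p < inner ℝ m x) (hn : q < inner ℝ n x) :
    p * q - √((‖m‖ ^ 2 - p ^ 2) * (‖n‖ ^ 2 - q ^ 2)) ≤ inner ℝ m n := by
  set p' := inner ℝ m x with hp'
  set q' := inner ℝ n x with hq'
  have hxx : inner ℝ x x = 1 := by rw [real_inner_self_eq_norm_sq, hx]; norm_num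
  have hmm : inner ℝ m m = ‖m‖ ^ 2 := real_inner_self_eq_norm_sq m
  have hnn : inner ℝ n n = ‖n‖ ^ 2 := real_inner_self_eq_norm_sq n
  have e0 : inner ℝ (m - p' • x) (n - q' • x) = inner ℝ m n - p' * q' := by
    simp only [inner_sub_left, inner_sub_right, real_inner_smul_left, real_inner_smul_right, hxx,
      real_inner_comm n x, ← hp', ← hq']
    ring
  have e1 : ‖m - p' • x‖ ^ 2 = ‖m‖ ^ 2 - p' ^ 2 := by
    rw [← real_inner_self_eq_norm_sq]
    simp only [inner_sub_left, inner_sub_right, real_inner_smul_left, real_inner_smul_right, hxx,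
      real_inner_comm m x, ← hp', hmm]
    ring
  have e2 : ‖n - q' • x‖ ^ 2 = ‖n‖ ^ 2 - q' ^ 2 := by
    rw [← real_inner_self_eq_norm_sq]
    simp only [inner_sub_left, inner_sub_right, real_inner_smul_left, real_inner_smul_right, hxx,
      real_inner_comm n x, ← hq', hnn]
    ring
  have h1 := abs_real_inner_le_norm (m - p' • x) (n - q' • x)
  rw [e0] at h1
  have h2 : ‖m - p' • x‖ * ‖n - q' • x‖ ≤ √((‖m‖ ^ 2 - p ^ 2) * (‖n‖ ^ 2 - q ^ 2)) := by
    apply Real.le_sqrt_of_sq_le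
    rw [mul_pow]
    have a1 := sq_nonneg ‖m - p' • x‖
    have a2 := sq_nonneg ‖n - q' • x‖
    have b1 : ‖m - p' • x‖ ^ 2 ≤ ‖m‖ ^ 2 - p ^ 2 := by rw [e1]; nlinarith
    have b2 : ‖n - q' • x‖ ^ 2 ≤ ‖n‖ ^ 2 - q ^ 2 := by rw [e2]; nlinarith
    exact mul_le_mul b1 b2 a2 (a1.trans b1)
  have h3 := neg_abs_le (inner ℝ m n - p' * q')
  nlinarith [mul_le_mul hm.le hn.le hq (hp.trans hm.le)]

theorem lt_mul_sub_sqrt {A B c : ℝ} (hA : 0 < A) (hA' : A < 1) (hB : 0 < B) (hB' : B < 1)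
    (h : c ≤ A + B - 1) (h' : A + B + 2 * c < 1) :
    c < A * B - √((A - A ^ 2) * (B - B ^ 2)) := by
  have hAB := mul_pos hA hB
  have hAB' := mul_pos (sub_pos.2 hA') (sub_pos.2 hB')
  rcases le_or_gt 1 (A + B) with ht | ht
  · have : √((A - A ^ 2) * (B - B ^ 2)) ≤ A * B :=
      Real.sqrt_le_iff.2 ⟨hAB.le, by nlinarith⟩
    linarith
  · have : √((A - A ^ 2) * (B - B ^ 2)) < (1 - A) * (1 - B) := by
      rw [Real.sqrt_lt' hAB']
      nlinarith
    nlinarith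

theorem norm_sq_midpoint {E : Type*} [NormedAddCommGroup E] [InnerProductSpace ℝ E]
    {x y : E} (hx : ‖x‖ = 1) (hy : ‖y‖ = 1) :
    ‖(2⁻¹ : ℝ) • (x + y)‖ ^ 2 = (1 + inner ℝ x y) / 2 := by
  simp only [norm_smul, mul_pow, norm_add_sq_real, hx, hy]
  norm_num
  ring

theorem inner_midpoint_lt {E : Type*} [NormedAddCommGroup E] [InnerProductSpace ℝ E]
    {x y z w : E} (hx : ‖x‖ = 1) (hy : ‖y‖ = 1) (hz : ‖z‖ = 1) (hw : ‖w‖ = 1)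
    (hxy : x ≠ y) (hzw : z ≠ w) (hlt : ‖(2⁻¹ : ℝ) • (x + y) + (2⁻¹ : ℝ) • (z + w)‖ < 1)
    (h₁ : inner ℝ x z + inner ℝ y w ≤ inner ℝ x y + inner ℝ z w)
    (h₂ : inner ℝ x w + inner ℝ y z ≤ inner ℝ x y + inner ℝ z w) :
    let m := (2⁻¹ : ℝ) • (x + y)
    let n := (2⁻¹ : ℝ) • (z + w)
    0 < ‖m‖ ^ 2 ∧ ‖m‖ ^ 2 < 1 ∧ 0 < ‖n‖ ^ 2 ∧ ‖n‖ ^ 2 < 1 ∧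
    inner ℝ m n < ‖m‖ ^ 2 * ‖n‖ ^ 2 -
      √((‖m‖ ^ 2 - (‖m‖ ^ 2) ^ 2) * (‖n‖ ^ 2 - (‖n‖ ^ 2) ^ 2)) := by
  intro m n
  have em : ‖m‖ ^ 2 = (1 + inner ℝ x y) / 2 := norm_sq_midpoint hx hy
  have en : ‖n‖ ^ 2 = (1 + inner ℝ z w) / 2 := norm_sq_midpoint hz hw
  have ec : inner ℝ m n = (inner ℝ x z + inner ℝ x w + inner ℝ y z + inner ℝ y w) / 4 := by
    simp only [m, n, real_inner_smul_left, real_inner_smul_right, inner_add_left, inner_add_right]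
    ring
  have hxy' := (inner_lt_one_iff_real_of_norm_eq_one hx hy).2 hxy
  have hzw' := (inner_lt_one_iff_real_of_norm_eq_one hz hw).2 hzw
  have h3 : ‖m‖ ^ 2 + ‖n‖ ^ 2 + 2 * inner ℝ m n < 1 := by
    have : ‖m + n‖ ^ 2 < 1 := by
      have := norm_nonneg (m + n)
      have h : ‖m + n‖ < 1 := hlt
      nlinarith
    rw [norm_add_sq_real] at this
    linarith
  -- This is the average of `h₁` and `h₂`.
  have hc : inner ℝ m n ≤ ‖m‖ ^ 2 + ‖n‖ ^ 2 - 1 := by rw [em, en, ec]; linarith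
  have hm1 : ‖m‖ ^ 2 < 1 := by linarith
  have hn1 : ‖n‖ ^ 2 < 1 := by linarith
  have hm0 : 0 < ‖m‖ ^ 2 := by
    by_contra h
    have hm : m = 0 := by simpa using le_antisymm (not_lt.1 h) (sq_nonneg _)
    rw [hm, inner_zero_left, norm_zero] at hc
    linarith
  have hn0 : 0 < ‖n‖ ^ 2 := by
    by_contra h
    have hn : n = 0 := by simpa using le_antisymm (not_lt.1 h) (sq_nonneg _)
    rw [hn, inner_zero_right, norm_zero] at hc
    linarith
  exact ⟨hm0, hm1, hn0, hn1, lt_mul_sub_sqrt hm0 hm1 hn0 hn1 hc h3⟩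

/-! ### Balancing six points of the plane -/

/-- The product of `((aᵢ - p)² + (bᵢ - q)² + t²) / t`. -/
noncomputable def distProd (a b : Fin 6 → ℝ) (v : ℝ × ℝ × ℝ) : ℝ :=
  ∏ i, ((a i - v.1) ^ 2 + (b i - v.2.1) ^ 2 + v.2.2 ^ 2) / v.2.2

theorem le_distProd_factor (x y : ℝ) {t : ℝ} (ht : 0 < t) : t ≤ (x ^ 2 + y ^ 2 + t ^ 2) / t := by
  rw [le_div_iff₀ ht]; nlinarith [sq_nonneg x, sq_nonneg y]

/-- Sublevel sets lie in a compact box. Distinctness is what keeps `t` away from `0`: near the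
boundary plane at most one factor can be small. -/
theorem exists_isMin_distProd {a b : Fin 6 → ℝ} (hab : Function.Injective fun i => (a i, b i)) :
    ∃ v : ℝ × ℝ × ℝ, 0 < v.2.2 ∧ ∀ w : ℝ × ℝ × ℝ, 0 < w.2.2 → distProd a b v ≤ distProd a b w := by
  obtain ⟨d, hd, hsep⟩ : ∃ d : ℝ, 0 < d ∧
      ∀ i j, i ≠ j → 4 * d ≤ (a i - a j) ^ 2 + (b i - b j) ^ 2 := by
    have key : ∀ i j, ∃ d : ℝ, 0 < d ∧ (i ≠ j → 4 * d ≤ (a i - a j) ^ 2 + (b i - b j) ^ 2) := by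
      intro i j
      by_cases hij : i = j
      · exact ⟨1, one_pos, fun h => absurd hij h⟩
      · refine ⟨((a i - a j) ^ 2 + (b i - b j) ^ 2) / 4, ?_, fun _ => by linarith⟩
        by_contra h
        have h1 : a i - a j = 0 := by nlinarith [sq_nonneg (a i - a j), sq_nonneg (b i - b j)]
        have h2 : b i - b j = 0 := by nlinarith [sq_nonneg (a i - a j), sq_nonneg (b i - b j)]
        exact hij (hab (Prod.ext (sub_eq_zero.1 h1) (sub_eq_zero.1 h2)))
    choose D hD hD' using key
    obtain ⟨p, -, hp⟩ := Finset.exists_min_image (Finset.univ : Finset (Fin 6 × Fin 6))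
      (fun p => D p.1 p.2) Finset.univ_nonempty
    exact ⟨D p.1 p.2, hD _ _, fun i j hij =>
      (mul_le_mul_of_nonneg_left (hp (i, j) (Finset.mem_univ _)) (by norm_num)).trans (hD' i j hij)⟩
  set F := distProd a b with hF
  set M := F (0, 0, 1) with hM
  have hpos : ∀ (v : ℝ × ℝ × ℝ), 0 < v.2.2 → ∀ i,
      0 < ((a i - v.1) ^ 2 + (b i - v.2.1) ^ 2 + v.2.2 ^ 2) / v.2.2 := fun v hv i =>
    hv.trans_le (le_distProd_factor _ _ hv)
  have hM0 : 0 < M := Finset.prod_pos fun i _ => hpos (0, 0, 1) one_pos i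
  -- a lower bound with one factor singled out
  have hone : ∀ (v : ℝ × ℝ × ℝ), 0 < v.2.2 → ∀ (i : Fin 6) (c : ℝ), 0 ≤ c →
      (∀ j, j ≠ i → c ≤ ((a j - v.1) ^ 2 + (b j - v.2.1) ^ 2 + v.2.2 ^ 2) / v.2.2) →
      ((a i - v.1) ^ 2 + (b i - v.2.1) ^ 2 + v.2.2 ^ 2) / v.2.2 * c ^ 5 ≤ F v := by
    intro v hv i c hc h
    rw [hF, distProd, ← Finset.mul_prod_erase _ _ (Finset.mem_univ i)]
    refine mul_le_mul_of_nonneg_left ?_ (hpos v hv i).le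
    calc c ^ 5 = ∏ _j ∈ Finset.univ.erase i, c := by
          rw [Finset.prod_const, Finset.card_erase_of_mem (Finset.mem_univ i)]; simp
      _ ≤ _ := Finset.prod_le_prod (fun _ _ => hc) fun j hj => h j (Finset.ne_of_mem_erase hj)
  have hT : ∀ v : ℝ × ℝ × ℝ, 0 < v.2.2 → F v ≤ M → v.2.2 ≤ 1 + M := by
    intro v hv hvM
    by_contra! h
    have h1 := hone v hv 0 v.2.2 hv.le fun j _ => le_distProd_factor _ _ hv
    have h2 : v.2.2 * v.2.2 ^ 5 ≤ _ := (mul_le_mul_of_nonneg_right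
      (le_distProd_factor (a 0 - v.1) (b 0 - v.2.1) hv) (by positivity)).trans h1
    have h3 : 1 ≤ v.2.2 ^ 5 := one_le_pow₀ (by linarith)
    nlinarith
  -- At most one point is within squared distance `d` of `(p, q)`, so five factors are at least `d /
  -- t` and the sixth at least `t`; hence `t * (d / t) ^ 5 ≤ M`.
  have hδ : ∀ v : ℝ × ℝ × ℝ, 0 < v.2.2 → F v ≤ M → d ^ 5 / M ≤ v.2.2 ^ 4 := by
    intro v hv hvM
    obtain ⟨i, hi⟩ : ∃ i : Fin 6, ∀ j, j ≠ i → d ≤ (a j - v.1) ^ 2 + (b j - v.2.1) ^ 2 := by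
      by_contra! h
      obtain ⟨j, -, hj⟩ := h 0
      obtain ⟨k, hk, hk'⟩ := h j
      have := hsep k j hk
      nlinarith [sq_nonneg (a k + a j - 2 * v.1), sq_nonneg (b k + b j - 2 * v.2.1)]
    have h1 := hone v hv i (d / v.2.2) (by positivity) fun j hj => by
      gcongr
      nlinarith [hi j hj]
    have h2 := (mul_le_mul_of_nonneg_right
      (le_distProd_factor (a i - v.1) (b i - v.2.1) hv) (by positivity)).trans (h1.trans hvM)
    rw [div_pow] at h2
    have h3 : v.2.2 * (d ^ 5 / v.2.2 ^ 5) = d ^ 5 / v.2.2 ^ 4 := by field_simp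
    rw [h3, div_le_iff₀ (by positivity)] at h2
    rw [div_le_iff₀ hM0]
    linarith
  obtain ⟨δ, hδ0, hδ'⟩ : ∃ δ : ℝ, 0 < δ ∧ ∀ v : ℝ × ℝ × ℝ, 0 < v.2.2 → F v ≤ M → δ ≤ v.2.2 := by
    refine ⟨min 1 (d ^ 5 / M), by positivity, fun v hv hvM => ?_⟩
    rcases le_total 1 v.2.2 with h | h
    · exact (min_le_left _ _).trans h
    · exact (min_le_right _ _).trans ((hδ v hv hvM).trans (pow_le_of_le_one hv.le h (by norm_num)))
  obtain ⟨R, hR0, hR⟩ : ∃ R : ℝ, 0 ≤ R ∧ ∀ v : ℝ × ℝ × ℝ, 0 < v.2.2 → F v ≤ M →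
      |a 0 - v.1| ≤ R ∧ |b 0 - v.2.1| ≤ R := by
    refine ⟨√(M / δ ^ 5 * (1 + M)), Real.sqrt_nonneg _, fun v hv hvM => ?_⟩
    have h0 := hδ' v hv hvM
    have h1 := (hone v hv 0 δ hδ0.le fun j _ => h0.trans (le_distProd_factor _ _ hv)).trans hvM
    rw [← le_div_iff₀ (by positivity), div_le_iff₀ hv] at h1
    have h2 := h1.trans (mul_le_mul_of_nonneg_left (hT v hv hvM) (by positivity))
    constructor <;> apply Real.abs_le_sqrt <;>
      nlinarith [sq_nonneg (a 0 - v.1), sq_nonneg (b 0 - v.2.1), sq_nonneg v.2.2]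
  set K : Set (ℝ × ℝ × ℝ) :=
    Set.Icc (a 0 - R) (a 0 + R) ×ˢ Set.Icc (b 0 - R) (b 0 + R) ×ˢ Set.Icc δ (1 + M) with hK
  have hKc : IsCompact K := isCompact_Icc.prod (isCompact_Icc.prod isCompact_Icc)
  have hmem : ∀ v : ℝ × ℝ × ℝ, 0 < v.2.2 → F v ≤ M → v ∈ K := by
    intro v hv hvM
    obtain ⟨h1, h2⟩ := hR v hv hvM
    rw [abs_le] at h1 h2
    exact ⟨⟨by linarith, by linarith⟩, ⟨by linarith, by linarith⟩, hδ' v hv hvM, hT v hv hvM⟩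
  have hbase : ((0, 0, 1) : ℝ × ℝ × ℝ) ∈ K := hmem _ one_pos le_rfl
  have hcont : ContinuousOn F K := by
    refine continuousOn_finsetProd _ fun i _ => ContinuousOn.div (by fun_prop) (by fun_prop) ?_
    exact fun v hv => (hδ0.trans_le hv.2.2.1).ne'
  obtain ⟨v, hvK, hv⟩ := hKc.exists_isMinOn ⟨_, hbase⟩ hcont
  refine ⟨v, hδ0.trans_le hvK.2.2.1, fun w hw => ?_⟩
  rcases le_or_gt (F w) M with h | h
  · exact hv (hmem w hw h)
  · exact (hv hbase).trans h.le

/-- The critical point equations of `log (distProd a b)` at its minimum, in `p`, `q` and `t`. -/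
theorem exists_balanced {a b : Fin 6 → ℝ} (hab : Function.Injective fun i => (a i, b i)) :
    ∃ p q t : ℝ, 0 < t ∧
      ∑ i, (a i - p) / ((a i - p) ^ 2 + (b i - q) ^ 2 + t ^ 2) = 0 ∧
      ∑ i, (b i - q) / ((a i - p) ^ 2 + (b i - q) ^ 2 + t ^ 2) = 0 ∧
      ∑ i, t ^ 2 / ((a i - p) ^ 2 + (b i - q) ^ 2 + t ^ 2) = 3 := by
  obtain ⟨⟨p, q, t⟩, ht, hmin⟩ := exists_isMin_distProd hab
  dsimp only at ht
  set L : ℝ × ℝ × ℝ → ℝ := fun v =>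
    ∑ i, (Real.log ((a i - v.1) ^ 2 + (b i - v.2.1) ^ 2 + v.2.2 ^ 2) - Real.log v.2.2) with hL
  have hLF : ∀ v : ℝ × ℝ × ℝ, 0 < v.2.2 → L v = Real.log (distProd a b v) := by
    intro v hv
    rw [distProd, Real.log_prod fun i _ => (hv.trans_le (le_distProd_factor _ _ hv)).ne']
    refine Finset.sum_congr rfl fun i _ => ?_
    rw [Real.log_div (by positivity) hv.ne']
  have hLmin : ∀ v : ℝ × ℝ × ℝ, 0 < v.2.2 → L (p, q, t) ≤ L v := by
    intro v hv
    rw [hLF _ ht, hLF _ hv]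
    exact Real.log_le_log
      (Finset.prod_pos fun i _ => ht.trans_le (le_distProd_factor _ _ ht)) (hmin v hv)
  have hD : ∀ i, (a i - p) ^ 2 + (b i - q) ^ 2 + t ^ 2 ≠ 0 := fun i => by positivity
  refine ⟨p, q, t, ht, ?_, ?_, ?_⟩
  · have hd : HasDerivAt (fun s => L (s, q, t))
        (∑ i, (2 * (a i - p) * (-1)) / ((a i - p) ^ 2 + (b i - q) ^ 2 + t ^ 2)) p := by
      refine HasDerivAt.fun_sum fun i _ => ?_
      have h : HasDerivAt (fun s => (a i - s) ^ 2 + (b i - q) ^ 2 + t ^ 2) (2 * (a i - p) * -1) p := by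
        have := (((hasDerivAt_id p).const_sub (a i)).pow 2).add_const ((b i - q) ^ 2)
        simpa using this.add_const (t ^ 2)
      exact (h.log (hD i)).sub_const (Real.log t)
    have h0 := IsLocalMin.hasDerivAt_eq_zero (.of_forall fun s => hLmin (s, q, t) ht) hd
    rw [← neg_eq_zero, ← mul_right_inj' (two_ne_zero' ℝ), mul_zero, ← h0, mul_neg, ← neg_mul,
      Finset.mul_sum]
    exact Finset.sum_congr rfl fun i _ => by ring
  · have hd : HasDerivAt (fun s => L (p, s, t))
        (∑ i, (2 * (b i - q) * (-1)) / ((a i - p) ^ 2 + (b i - q) ^ 2 + t ^ 2)) q := by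
      refine HasDerivAt.fun_sum fun i _ => ?_
      have h : HasDerivAt (fun s => (a i - p) ^ 2 + (b i - s) ^ 2 + t ^ 2) (2 * (b i - q) * -1) q := by
        have := (((hasDerivAt_id q).const_sub (b i)).pow 2).const_add ((a i - p) ^ 2)
        simpa using this.add_const (t ^ 2)
      exact (h.log (hD i)).sub_const (Real.log t)
    have h0 := IsLocalMin.hasDerivAt_eq_zero (.of_forall fun s => hLmin (p, s, t) ht) hd
    rw [← neg_eq_zero, ← mul_right_inj' (two_ne_zero' ℝ), mul_zero, ← h0, mul_neg, ← neg_mul,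
      Finset.mul_sum]
    exact Finset.sum_congr rfl fun i _ => by ring
  · have hd : HasDerivAt (fun s => L (p, q, s))
        (∑ i, ((2 * t) / ((a i - p) ^ 2 + (b i - q) ^ 2 + t ^ 2) - t⁻¹)) t := by
      refine HasDerivAt.fun_sum fun i _ => HasDerivAt.sub (HasDerivAt.log ?_ (hD i))
        (Real.hasDerivAt_log ht.ne')
      have := ((hasDerivAt_id t).pow 2).const_add ((a i - p) ^ 2 + (b i - q) ^ 2)
      simpa using this
    have h0 := IsLocalMin.hasDerivAt_eq_zero
      (((lt_mem_nhds ht).mono fun s hs => hLmin (p, q, s) hs)) hd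
    have h1 : ∀ i, (2 * t) / ((a i - p) ^ 2 + (b i - q) ^ 2 + t ^ 2) - t⁻¹ =
        2 / t * (t ^ 2 / ((a i - p) ^ 2 + (b i - q) ^ 2 + t ^ 2)) - t⁻¹ := by
      intro i; field_simp
    simp only [h1, Finset.sum_sub_distrib, ← Finset.mul_sum, Finset.sum_const] at h0
    rw [Finset.card_univ, Fintype.card_fin, nsmul_eq_mul] at h0
    generalize ∑ i, t ^ 2 / ((a i - p) ^ 2 + (b i - q) ^ 2 + t ^ 2) = S at h0 ⊢
    field_simp at h0
    push_cast at h0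
    linarith

/-! ### Discs in the Riemann sphere -/

theorem IsOpenDisc.smul_image {D : Set (OnePoint ℂ)} (hD : IsOpenDisc D)
    (g : Matrix.GeneralLinearGroup (Fin 2) ℂ) : IsOpenDisc ((fun z => g • z) '' D) := by
  obtain ⟨h, rfl⟩ := hD
  refine ⟨g * h, ?_⟩
  rw [Set.image_image]
  simp only [mul_smul]

theorem isOpenDisc_ball (c : ℂ) {r : ℝ} (hr : 0 < r) :
    IsOpenDisc ((fun w : ℂ => (w : OnePoint ℂ)) '' Metric.ball c r) := by
  have hr' : (r : ℂ) ≠ 0 := by exact_mod_cast hr.ne'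
  refine ⟨.mkOfDetNeZero !![(r : ℂ), c; 0, 1] (by simpa using hr'), ?_⟩
  have key : ∀ w : ℂ, Matrix.GeneralLinearGroup.mkOfDetNeZero !![(r : ℂ), c; 0, 1]
      (by simpa using hr') • (w : OnePoint ℂ) = ((r * w + c : ℂ) : OnePoint ℂ) := by
    intro w
    rw [OnePoint.smul_some_eq_ite]
    simp [Matrix.GeneralLinearGroup.mkOfDetNeZero]
  rw [Set.image_image]
  simp only [key]
  ext z
  constructor
  · rintro ⟨w, hw, rfl⟩
    refine ⟨(w - c) / r, ?_, ?_⟩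
    · rw [mem_ball_iff_norm] at hw
      rw [mem_ball_zero_iff, norm_div, Complex.norm_of_nonneg hr.le, div_lt_one hr]
      exact hw
    · simp only [OnePoint.coe_eq_coe]
      field_simp
      ring
  · rintro ⟨w, hw, rfl⟩
    refine ⟨r * w + c, ?_, rfl⟩
    rw [mem_ball_zero_iff] at hw
    rw [mem_ball_iff_norm, add_sub_cancel_right, norm_mul, Complex.norm_of_nonneg hr.le]
    nlinarith

theorem isOpenDisc_compl_closedBall (c : ℂ) {r : ℝ} (hr : 0 < r) :
    IsOpenDisc (insert OnePoint.infty
      ((fun w : ℂ => (w : OnePoint ℂ)) '' (Metric.closedBall c r)ᶜ)) := by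
  have hr' : (r : ℂ) ≠ 0 := by exact_mod_cast hr.ne'
  refine ⟨.mkOfDetNeZero !![c, (r : ℂ); 1, 0] (by simpa using hr'), ?_⟩
  have key : ∀ w : ℂ, Matrix.GeneralLinearGroup.mkOfDetNeZero !![c, (r : ℂ); 1, 0]
      (by simpa using hr') • (w : OnePoint ℂ) =
      if w = 0 then OnePoint.infty else (((c * w + r) / w : ℂ) : OnePoint ℂ) := by
    intro w
    rw [OnePoint.smul_some_eq_ite]
    simp [Matrix.GeneralLinearGroup.mkOfDetNeZero]
  rw [Set.image_image]
  simp only [key]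
  ext z
  constructor
  · rintro (rfl | ⟨w, hw, rfl⟩)
    · exact ⟨0, by simp, by simp⟩
    · rw [Set.mem_compl_iff, mem_closedBall_iff_norm, not_le] at hw
      have hwc : w - c ≠ 0 := norm_pos_iff.1 (hr.trans hw)
      refine ⟨r / (w - c), ?_, ?_⟩
      · rw [mem_ball_zero_iff, norm_div, Complex.norm_of_nonneg hr.le, div_lt_one (hr.trans hw)]
        exact hw
      · simp only [div_eq_zero_iff, hr', hwc, or_self, if_false, OnePoint.coe_eq_coe]
        field_simp
        ring
  · rintro ⟨w, hw, rfl⟩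
    by_cases h : w = 0
    · left; simp [h]
    · right
      simp only [h, if_false]
      refine ⟨_, ?_, rfl⟩
      rw [mem_ball_zero_iff] at hw
      have hw0 := norm_pos_iff.2 h
      have e : (c * w + r) / w - c = r / w := by field_simp; ring
      rw [Set.mem_compl_iff, mem_closedBall_iff_norm, not_le, e, norm_div,
        Complex.norm_of_nonneg hr.le, lt_div_iff₀ hw0]
      nlinarith

/-! ### Stereographic projection and caps -/

/-- The inverse stereographic projection of the Riemann sphere onto the unit sphere of `ℝ³`. -/
noncomputable def toSphere (p : OnePoint ℂ) : EuclideanSpace ℝ (Fin 3) :=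
  p.elim !₂[0, 0, 1] fun z =>
    !₂[2 * z.re / (z.re ^ 2 + z.im ^ 2 + 1), 2 * z.im / (z.re ^ 2 + z.im ^ 2 + 1),
      1 - 2 / (z.re ^ 2 + z.im ^ 2 + 1)]

theorem toSphere_infty : toSphere OnePoint.infty = !₂[0, 0, 1] := rfl

theorem toSphere_coe (z : ℂ) : toSphere z =
    !₂[2 * z.re / (z.re ^ 2 + z.im ^ 2 + 1), 2 * z.im / (z.re ^ 2 + z.im ^ 2 + 1),
      1 - 2 / (z.re ^ 2 + z.im ^ 2 + 1)] := rfl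

theorem norm_toSphere (p : OnePoint ℂ) : ‖toSphere p‖ = 1 := by
  rw [EuclideanSpace.norm_eq, Real.sqrt_eq_one]
  cases p with
  | infty => simp [toSphere_infty, Fin.sum_univ_three]
  | coe z =>
    have : z.re ^ 2 + z.im ^ 2 + 1 ≠ 0 := by positivity
    simp only [toSphere_coe, Fin.sum_univ_three, Real.norm_eq_abs, sq_abs]
    simp
    field_simp
    ring

theorem toSphere_injective : Function.Injective toSphere := by
  have aux : ∀ z : ℂ, toSphere z ≠ toSphere OnePoint.infty := by
    intro z h
    have h2 := congrArg (fun v : EuclideanSpace ℝ (Fin 3) => v 2) h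
    simp [toSphere_coe, toSphere_infty] at h2
    have : 0 < z.re ^ 2 + z.im ^ 2 + 1 := by positivity
    exact this.ne' h2
  intro p q h
  cases p with
  | infty =>
    cases q with
    | infty => rfl
    | coe w => exact absurd h.symm (aux w)
  | coe z =>
    cases q with
    | infty => exact absurd h (aux z)
    | coe w =>
      have h0 := congrArg (fun v : EuclideanSpace ℝ (Fin 3) => v 0) h
      have h1 := congrArg (fun v : EuclideanSpace ℝ (Fin 3) => v 1) h
      have h2 := congrArg (fun v : EuclideanSpace ℝ (Fin 3) => v 2) h
      have hz : 0 < z.re ^ 2 + z.im ^ 2 + 1 := by positivity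
      have hw : 0 < w.re ^ 2 + w.im ^ 2 + 1 := by positivity
      simp only [toSphere_coe] at h0 h1 h2
      have h3 : z.re ^ 2 + z.im ^ 2 + 1 = w.re ^ 2 + w.im ^ 2 + 1 := by
        have h4 : 2 / (z.re ^ 2 + z.im ^ 2 + 1) = 2 / (w.re ^ 2 + w.im ^ 2 + 1) := by simpa using h2
        field_simp at h4
        exact h4.symm
      simp only [h3] at h0 h1
      congr 1
      apply Complex.ext
      · simpa [hw.ne', div_left_inj'] using h0
      · simpa [hw.ne', div_left_inj'] using h1

theorem inner_toSphere_coe (m : EuclideanSpace ℝ (Fin 3)) (z : ℂ) :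
    inner ℝ m (toSphere z) =
      m 2 + 2 * (m 0 * z.re + m 1 * z.im - m 2) / (z.re ^ 2 + z.im ^ 2 + 1) := by
  simp [toSphere_coe, PiLp.inner_apply, Fin.sum_univ_three]
  ring

theorem inner_toSphere_infty (m : EuclideanSpace ℝ (Fin 3)) :
    inner ℝ m (toSphere OnePoint.infty) = m 2 := by
  simp [toSphere_infty, PiLp.inner_apply, Fin.sum_univ_three]

/-- A spherical cap whose boundary does not pass through `∞` is an open disc. -/
theorem isOpenDisc_cap {m : EuclideanSpace ℝ (Fin 3)} {k : ℝ} (hk : |k| < ‖m‖) (hk' : k ≠ m 2) :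
    IsOpenDisc {p | k < inner ℝ m (toSphere p)} := by
  set α := m 2 - k with hα
  have hα0 : α ≠ 0 := sub_ne_zero.2 hk'.symm
  set c : ℂ := ⟨-m 0 / α, -m 1 / α⟩ with hc
  set r : ℝ := √(‖m‖ ^ 2 - k ^ 2) / |α| with hr
  have hpos : 0 < ‖m‖ ^ 2 - k ^ 2 := by
    rw [sub_pos, ← sq_abs k]
    exact pow_lt_pow_left₀ hk (abs_nonneg k) two_ne_zero
  have hr0 : 0 < r := div_pos (Real.sqrt_pos.2 hpos) (abs_pos.2 hα0)
  have hr2 : r ^ 2 = (m 0 ^ 2 + m 1 ^ 2 + m 2 ^ 2 - k ^ 2) / α ^ 2 := by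
    rw [hr, div_pow, Real.sq_sqrt hpos.le, sq_abs, EuclideanSpace.norm_sq_eq]
    simp [Fin.sum_univ_three]
  have key : ∀ z : ℂ, k < inner ℝ m (toSphere z) ↔ 0 < α * (‖z - c‖ ^ 2 - r ^ 2) := by
    -- Clearing the positive denominator turns the cap inequality into a circle equation, with
    -- leading coefficient `α`; its sign decides between inside and outside.
    intro z
    have hz : 0 < z.re ^ 2 + z.im ^ 2 + 1 := by positivity
    have e1 : α * (‖z - c‖ ^ 2 - r ^ 2) =
        (inner ℝ m (toSphere z) - k) * (z.re ^ 2 + z.im ^ 2 + 1) := by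
      rw [inner_toSphere_coe, hr2, ← Complex.normSq_eq_norm_sq, Complex.normSq_apply]
      simp only [Complex.sub_re, Complex.sub_im, hc]
      field_simp
      rw [hα]
      ring
    rw [e1, mul_pos_iff_of_pos_right hz, sub_pos]
  rcases lt_or_gt_of_ne hα0 with h | h
  · convert isOpenDisc_ball c hr0
    ext p
    cases p with
    | infty =>
      simp only [Set.mem_ofPred_eq, inner_toSphere_infty]
      simp
      linarith
    | coe z =>
      simp only [Set.mem_ofPred_eq, key, OnePoint.coe_injective.mem_set_image, mem_ball_iff_norm]
      rw [← neg_mul_neg, mul_pos_iff_of_pos_left (neg_pos.2 h), neg_sub, sub_pos,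
        sq_lt_sq₀ (norm_nonneg _) hr0.le]
  · convert isOpenDisc_compl_closedBall c hr0
    ext p
    cases p with
    | infty =>
      simp only [Set.mem_ofPred_eq, inner_toSphere_infty]
      simp
      linarith
    | coe z =>
      simp only [Set.mem_ofPred_eq, key, Set.mem_insert_iff, OnePoint.coe_ne_infty, false_or,
        OnePoint.coe_injective.mem_set_image, Set.mem_compl_iff, mem_closedBall_iff_norm, not_le]
      rw [mul_pos_iff_of_pos_left h, sub_pos, sq_lt_sq₀ hr0.le (norm_nonneg _)]

/-! ### Möbius normalization to centroid zero -/

theorem exists_smul_sum_toSphere_eq_zero {p : Fin 6 → OnePoint ℂ} (hp : Function.Injective p) :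
    ∃ g : Matrix.GeneralLinearGroup (Fin 2) ℂ, ∑ i, toSphere (g • p i) = 0 := by
  obtain ⟨c, hc⟩ : ∃ c : ℂ, ∀ i, p i ≠ c := by
    obtain ⟨c, hc⟩ := ((Set.finite_range p).preimage
      (OnePoint.coe_injective (X := ℂ)).injOn).exists_notMem
    exact ⟨c, fun i hi => hc ⟨i, hi⟩⟩
  -- `z ↦ 1 / (z - c)` makes all six points finite.
  set g₀ : Matrix.GeneralLinearGroup (Fin 2) ℂ := .mkOfDetNeZero !![0, 1; 1, -c] (by simp) with hg₀
  have h₀ : ∀ i, ∃ z : ℂ, (z : OnePoint ℂ) = g₀ • p i := by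
    intro i
    rw [← OnePoint.ne_infty_iff_exists]
    have : g₀ • (c : OnePoint ℂ) = OnePoint.infty := by
      rw [OnePoint.smul_some_eq_ite]
      simp [hg₀, Matrix.GeneralLinearGroup.mkOfDetNeZero]
    rw [← this]
    exact fun h => hc i (MulAction.injective g₀ h)
  choose z hz using h₀
  have hzi : Function.Injective z := fun i j h =>
    hp (MulAction.injective g₀ (by simp only [← hz, h]))
  obtain ⟨a, b, t, ht, ha, hb, hab⟩ := exists_balanced (a := fun i => (z i).re)
    (b := fun i => (z i).im) fun i j h => hzi (Complex.ext (Prod.ext_iff.1 h).1 (Prod.ext_iff.1 h).2)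
  have ht' : (t : ℂ) ≠ 0 := by exact_mod_cast ht.ne'
  set g₁ : Matrix.GeneralLinearGroup (Fin 2) ℂ :=
    .mkOfDetNeZero !![1, -(⟨a, b⟩ : ℂ); 0, (t : ℂ)] (by simpa using ht') with hg₁
  have h₁ : ∀ i, (g₁ * g₀) • p i = (((z i - ⟨a, b⟩) / (t : ℂ) : ℂ) : OnePoint ℂ) := by
    intro i
    rw [mul_smul, ← hz, OnePoint.smul_some_eq_ite]
    simp [hg₁, Matrix.GeneralLinearGroup.mkOfDetNeZero, ht', sub_eq_add_neg]
  have hD : ∀ i, 0 < ((z i).re - a) ^ 2 + ((z i).im - b) ^ 2 + t ^ 2 := fun i => by positivity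
  have h₂ : ∀ i, toSphere ((g₁ * g₀) • p i) =
      !₂[2 * t * (((z i).re - a) / (((z i).re - a) ^ 2 + ((z i).im - b) ^ 2 + t ^ 2)),
        2 * t * (((z i).im - b) / (((z i).re - a) ^ 2 + ((z i).im - b) ^ 2 + t ^ 2)),
        1 - 2 * (t ^ 2 / (((z i).re - a) ^ 2 + ((z i).im - b) ^ 2 + t ^ 2))] := by
    intro i
    have := (hD i).ne'
    have e : (((z i).re - a) / t) ^ 2 + (((z i).im - b) / t) ^ 2 + 1 =
        (((z i).re - a) ^ 2 + ((z i).im - b) ^ 2 + t ^ 2) / t ^ 2 := by field_simp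
    rw [h₁, toSphere_coe]
    simp only [Complex.div_ofReal_re, Complex.div_ofReal_im, Complex.sub_re, Complex.sub_im, e]
    congr 2
    · field_simp
    · congr 1
      · field_simp
      · congr 1
        field_simp
  refine ⟨g₁ * g₀, ?_⟩
  simp only [h₂]
  ext j
  simp only [WithLp.ofLp_sum, Finset.sum_apply]
  fin_cases j
  · simpa [← Finset.mul_sum] using Or.inr ha
  · simpa [← Finset.mul_sum] using Or.inr hb
  · simp [Finset.sum_sub_distrib, ← Finset.mul_sum, hab]
    norm_num

/-! ### The optimal matching and its caps -/

/-- The spherical cap of points whose image `x` satisfies `⟪m, x⟫ > ‖m‖² - ε`. -/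
def cap (m : EuclideanSpace ℝ (Fin 3)) (ε : ℝ) : Set (OnePoint ℂ) :=
  {p | ‖m‖ ^ 2 - ε < inner ℝ m (toSphere p)}

theorem eventually_isOpenDisc_cap {m : EuclideanSpace ℝ (Fin 3)} (h0 : 0 < ‖m‖ ^ 2)
    (h1 : ‖m‖ ^ 2 < 1) : ∀ᶠ ε : ℝ in 𝓝[>] 0, IsOpenDisc (cap m ε) := by
  -- The one excluded `ε` puts `∞` on the boundary of the cap.
  have hne : ∀ᶠ ε : ℝ in 𝓝[>] 0, ε ≠ ‖m‖ ^ 2 - m 2 := by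
    rcases eq_or_ne (0 : ℝ) (‖m‖ ^ 2 - m 2) with h | h
    · rw [← h]
      exact eventually_mem_nhdsWithin.mono fun ε hε => (Set.mem_Ioi.1 hε).ne'
    · exact eventually_nhdsWithin_of_eventually_nhds (eventually_ne_nhds h)
  filter_upwards [hne, eventually_mem_nhdsWithin,
    eventually_nhdsWithin_of_eventually_nhds (eventually_lt_nhds h0)] with ε h2 h3 h4
  have h3 : 0 < ε := h3
  refine isOpenDisc_cap ?_ fun h => h2 (by linarith)
  rw [abs_of_pos (by linarith)]
  nlinarith [norm_nonneg m]

theorem eventually_disjoint_cap {m n : EuclideanSpace ℝ (Fin 3)} (hm : 0 < ‖m‖ ^ 2)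
    (hn : 0 < ‖n‖ ^ 2) (h : inner ℝ m n < ‖m‖ ^ 2 * ‖n‖ ^ 2 -
      √((‖m‖ ^ 2 - (‖m‖ ^ 2) ^ 2) * (‖n‖ ^ 2 - (‖n‖ ^ 2) ^ 2))) :
    ∀ᶠ ε : ℝ in 𝓝[>] 0, Disjoint (cap m ε) (cap n ε) := by
  have hc : Continuous fun ε : ℝ => (‖m‖ ^ 2 - ε) * (‖n‖ ^ 2 - ε) -
      √((‖m‖ ^ 2 - (‖m‖ ^ 2 - ε) ^ 2) * (‖n‖ ^ 2 - (‖n‖ ^ 2 - ε) ^ 2)) := by fun_prop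
  have hev := (hc.tendsto 0).eventually_const_lt (by simpa using h)
  filter_upwards [eventually_nhdsWithin_of_eventually_nhds hev,
    eventually_nhdsWithin_of_eventually_nhds (eventually_lt_nhds hm),
    eventually_nhdsWithin_of_eventually_nhds (eventually_lt_nhds hn)] with ε h1 h2 h3
  rw [Set.disjoint_left]
  intro p hp hp'
  exact h1.not_ge (caps_separate (norm_toSphere p) (by linarith) (by linarith) hp hp')

theorem mem_cap_midpoint (p q : OnePoint ℂ) {ε : ℝ} (hε : 0 < ε) :
    p ∈ cap ((2⁻¹ : ℝ) • (toSphere p + toSphere q)) ε ∧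
      q ∈ cap ((2⁻¹ : ℝ) • (toSphere p + toSphere q)) ε := by
  simp only [cap, Set.mem_ofPred_eq, norm_sq_midpoint (norm_toSphere p) (norm_toSphere q),
    real_inner_smul_left, inner_add_left, real_inner_self_eq_norm_sq, norm_toSphere,
    real_inner_comm (toSphere p) (toSphere q)]
  constructor <;> linarith

theorem exists_disjoint_discs {q : Fin 6 → OnePoint ℂ} (hq : Function.Injective q)
    (hsum : ∑ i, toSphere (q i) = 0) :
    ∃ τ : Equiv.Perm (Fin 6), ∃ D₁ D₂ D₃ : Set (OnePoint ℂ),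
      IsOpenDisc D₁ ∧ IsOpenDisc D₂ ∧ IsOpenDisc D₃ ∧
      Disjoint D₁ D₂ ∧ Disjoint D₁ D₃ ∧ Disjoint D₂ D₃ ∧
      (q (τ 0) ∈ D₁ ∧ q (τ 1) ∈ D₁) ∧ (q (τ 2) ∈ D₂ ∧ q (τ 3) ∈ D₂) ∧
      (q (τ 4) ∈ D₃ ∧ q (τ 5) ∈ D₃) := by
  obtain ⟨τ, -, hτ⟩ := Finset.exists_max_image (Finset.univ : Finset (Equiv.Perm (Fin 6)))
    (fun τ => inner ℝ (toSphere (q (τ 0))) (toSphere (q (τ 1))) +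
      inner ℝ (toSphere (q (τ 2))) (toSphere (q (τ 3))) +
      inner ℝ (toSphere (q (τ 4))) (toSphere (q (τ 5)))) Finset.univ_nonempty
  set x : Fin 6 → EuclideanSpace ℝ (Fin 3) := fun i => toSphere (q (τ i)) with hx
  have hmax : ∀ σ : Equiv.Perm (Fin 6),
      inner ℝ (x (σ 0)) (x (σ 1)) + inner ℝ (x (σ 2)) (x (σ 3)) + inner ℝ (x (σ 4)) (x (σ 5)) ≤
      inner ℝ (x 0) (x 1) + inner ℝ (x 2) (x 3) + inner ℝ (x 4) (x 5) := fun σ =>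
    hτ (τ * σ) (Finset.mem_univ _)
  have hn : ∀ i, ‖x i‖ = 1 := fun i => norm_toSphere _
  have hinj : Function.Injective x := toSphere_injective.comp (hq.comp τ.injective)
  have hx0 : x 0 + x 1 + x 2 + x 3 + x 4 + x 5 = 0 := by
    rw [← hsum, ← Equiv.sum_comp τ, Fin.sum_univ_six]
  have hlt : ∀ i j, i ≠ j → ‖(2⁻¹ : ℝ) • (x i + x j)‖ < 1 := by
    intro i j hij
    have h := (inner_lt_one_iff_real_of_norm_eq_one (hn i) (hn j)).2 (hinj.ne hij)
    rw [← sq_lt_one_iff₀ (norm_nonneg _), norm_sq_midpoint (hn i) (hn j)]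
    linarith
  have hlt' : ∀ i j k l m n, m ≠ n → x i + x j + x k + x l + x m + x n = 0 →
      ‖(2⁻¹ : ℝ) • (x i + x j) + (2⁻¹ : ℝ) • (x k + x l)‖ < 1 := by
    intro i j k l m n hmn h
    have : (2⁻¹ : ℝ) • (x i + x j) + (2⁻¹ : ℝ) • (x k + x l) = -((2⁻¹ : ℝ) • (x m + x n)) := by
      rw [← smul_add, ← smul_neg]
      congr 1
      rw [eq_neg_iff_add_eq_zero, ← h]
      abel
    rw [this, norm_neg]
    exact hlt m n hmn
  -- For each two of the three pairs, the two ways of re-pairing their four points.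
  have s12 := hmax (Equiv.swap 1 2)
  have s13 := hmax (Equiv.swap 1 3)
  have s14 := hmax (Equiv.swap 1 4)
  have s15 := hmax (Equiv.swap 1 5)
  have s34 := hmax (Equiv.swap 3 4)
  have s35 := hmax (Equiv.swap 3 5)
  simp [Equiv.swap_apply_def] at s12 s13 s14 s15 s34 s35
  obtain ⟨a0, a1, b0, b1, hab⟩ := inner_midpoint_lt (hn 0) (hn 1) (hn 2) (hn 3)
    (hinj.ne (by decide)) (hinj.ne (by decide)) (hlt' 0 1 2 3 4 5 (by decide) hx0)
    (by linarith) (by linarith [real_inner_comm (x 1) (x 2)])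
  obtain ⟨-, -, c0, c1, hac⟩ := inner_midpoint_lt (hn 0) (hn 1) (hn 4) (hn 5)
    (hinj.ne (by decide)) (hinj.ne (by decide))
    (hlt' 0 1 4 5 2 3 (by decide) (by rw [← hx0]; abel))
    (by linarith) (by linarith [real_inner_comm (x 1) (x 4)])
  obtain ⟨-, -, -, -, hbc⟩ := inner_midpoint_lt (hn 2) (hn 3) (hn 4) (hn 5)
    (hinj.ne (by decide)) (hinj.ne (by decide))
    (hlt' 2 3 4 5 0 1 (by decide) (by rw [← hx0]; abel))
    (by linarith) (by linarith [real_inner_comm (x 3) (x 4)])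
  obtain ⟨ε, h1, h2, h3, h4, h5, h6, hε⟩ := ((eventually_isOpenDisc_cap a0 a1).and
    ((eventually_isOpenDisc_cap b0 b1).and ((eventually_isOpenDisc_cap c0 c1).and
    ((eventually_disjoint_cap a0 b0 hab).and ((eventually_disjoint_cap a0 c0 hac).and
    ((eventually_disjoint_cap b0 c0 hbc).and eventually_mem_nhdsWithin)))))).exists
  exact ⟨τ, _, _, _, h1, h2, h3, h4, h5, h6, mem_cap_midpoint _ _ hε, mem_cap_midpoint _ _ hε,
    mem_cap_midpoint _ _ hε⟩

/-! ### Counting points and pulling back -/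

theorem ncard_inter_range_eq_two {ι X : Type*} {q : ι → X} (hq : Function.Injective q)
    {D : Set X} {i j : ι} (hij : i ≠ j) (hD : ∀ k, q k ∈ D ↔ k = i ∨ k = j) :
    (D ∩ Set.range q).ncard = 2 := by
  have : D ∩ Set.range q = {q i, q j} := by
    ext y
    constructor
    · rintro ⟨hy, k, rfl⟩
      rcases (hD k).1 hy with rfl | rfl <;> simp
    · rintro (rfl | rfl)
      · exact ⟨(hD i).2 (.inl rfl), i, rfl⟩
      · exact ⟨(hD j).2 (.inr rfl), j, rfl⟩
  rw [this, Set.ncard_pair (hq.ne hij)]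

theorem theorem2 (A : Set (OnePoint ℂ)) (hA : A.ncard = 6) :
    ∃ D₁ D₂ D₃ : Set (OnePoint ℂ),
      IsOpenDisc D₁ ∧ IsOpenDisc D₂ ∧ IsOpenDisc D₃ ∧
      Disjoint D₁ D₂ ∧ Disjoint D₁ D₃ ∧ Disjoint D₂ D₃ ∧
      (D₁ ∩ A).ncard = 2 ∧ (D₂ ∩ A).ncard = 2 ∧ (D₃ ∩ A).ncard = 2 := by
  have hfin : A.Finite := Set.finite_of_ncard_ne_zero (by omega)
  obtain ⟨p, hp, rfl⟩ : ∃ p : Fin 6 → OnePoint ℂ, Function.Injective p ∧ Set.range p = A := by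
    have := hfin.fintype
    have e : A ≃ Fin 6 := Fintype.equivFinOfCardEq (by rw [← Nat.card_eq_fintype_card]; exact hA)
    refine ⟨fun i => (e.symm i : OnePoint ℂ), Subtype.val_injective.comp e.symm.injective, ?_⟩
    exact (e.symm.surjective.range_comp _).trans Subtype.range_coe
  obtain ⟨g, hg⟩ := exists_smul_sum_toSphere_eq_zero hp
  obtain ⟨τ, D₁, D₂, D₃, h1, h2, h3, h12, h13, h23, ⟨m0, m1⟩, ⟨m2, m3⟩, ⟨m4, m5⟩⟩ :=
    exists_disjoint_discs ((MulAction.injective g).comp hp) hg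
  have hinj := MulAction.injective (β := OnePoint ℂ) g⁻¹
  have hmem : ∀ (D : Set (OnePoint ℂ)) (i : Fin 6),
      p (τ i) ∈ (fun z => g⁻¹ • z) '' D ↔ g • p (τ i) ∈ D := by
    intro D i
    constructor
    · rintro ⟨w, hw, h⟩
      rwa [← h, smul_inv_smul]
    · exact fun h => ⟨_, h, inv_smul_smul _ _⟩
  have hr : Set.range p = Set.range (p ∘ τ) := (τ.surjective.range_comp p).symm
  have d12 := Set.disjoint_left.1 h12
  have d13 := Set.disjoint_left.1 h13
  have d23 := Set.disjoint_left.1 h23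
  have d21 := Set.disjoint_right.1 h12
  have d31 := Set.disjoint_right.1 h13
  have d32 := Set.disjoint_right.1 h23
  simp only [Function.comp_apply] at m0 m1 m2 m3 m4 m5
  refine ⟨_, _, _, h1.smul_image g⁻¹, h2.smul_image g⁻¹, h3.smul_image g⁻¹,
    (Set.disjoint_image_iff hinj).2 h12, (Set.disjoint_image_iff hinj).2 h13,
    (Set.disjoint_image_iff hinj).2 h23, ?_, ?_, ?_⟩ <;> rw [hr]
  · refine ncard_inter_range_eq_two (hp.comp τ.injective) (i := 0) (j := 1) (by decide) fun k => ?_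
    rw [Function.comp_apply, hmem]
    fin_cases k <;> simp [m0, m1, d21 m2, d21 m3, d31 m4, d31 m5]
  · refine ncard_inter_range_eq_two (hp.comp τ.injective) (i := 2) (j := 3) (by decide) fun k => ?_
    rw [Function.comp_apply, hmem]
    fin_cases k <;> simp [m2, m3, d12 m0, d12 m1, d32 m4, d32 m5]
  · refine ncard_inter_range_eq_two (hp.comp τ.injective) (i := 4) (j := 5) (by decide) fun k => ?_
    rw [Function.comp_apply, hmem]
    fin_cases k <;> simp [m4, m5, d13 m0, d13 m1, d23 m2, d23 m3]
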